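/- Let $\{p_k\}_{k\ge 0}$ be an offspring distribution with mean $m\in(0,1)$ and finite third moment, and let $\{a_y\}_{y\in\mathbb Z}$ be a jump distribution with $a_0\neq 1$, mean zero, finite variance, and $K(\theta):=\sum_{y\in\mathbb Z}a_y\theta^y<\infty$ for all $\theta\ge 1$. Consider the branching random walk on $\mathbb Z$ started from one particle at the origin in generation $0$, in which, in every generation, each particle first jumps according to $\{a_y\}$ and then is replaced, at the site it has reached, by a random number of children distributed according to $\{p_k\}$, all jumps and all offspring numbers being independent. (A particle's position is the site at which it is born; in particular all children of the same particle have the same position.) For $k\ge 0$ let $M_k$ be the maximal position of the particles of generations $0,\dots,k$, and let $M=\sup_{k\ge 0}M_k$. Then there is exactly one $\rho\in(1,\infty)$ with $K(\rho)=1/m$, and for every real number $a>-\dfrac{\log\rho}{\log m}$, $$\lim_{n\to\infty}P\big(M_{\lfloor an\rfloor}\ge n \,\big|\, M\ge n\big)=1 .$$ -/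

import Mathlib

open Filter Topology MeasureTheory ProbabilityTheory

noncomputable section

namespace BRW

/-! Particles are labelled by Ulam-Harris words, i.e. lists of natural numbers: the root is `[]` and
`i :: v` is the `i`-th child (counted from `0`) of `v`. The generation of `v` is `v.length`. -/

/-- The genealogical Galton-Watson tree in which the particle `v` has `N v` children. -/
def tree (N : List ℕ → ℕ) : Set (List ℕ) := {v | go v}
where
  /-- `v` is a particle that is actually born. -/
  go : List ℕ → Prop
    | [] => True
    | i :: v => go v ∧ i < N v

/-- The position `X(v)` of the particle `v`, when `Y v` is the jump that the particle `v` performs.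
The root starts at the origin. A particle first jumps and then reproduces at the site reached, so
all the children of `v` are located at `X(v) + Y v`. -/
def position (Y : List ℕ → ℤ) : List ℕ → ℤ
  | [] => 0
  | _ :: v => position Y v + Y v

/-- `M_n`, the rightmost position reached up to generation `n` (a maximum over a finite nonempty
set, taken in the extended reals). -/
def maxUpTo (N : List ℕ → ℕ) (Y : List ℕ → ℤ) (n : ℕ) : EReal :=
  ⨆ v ∈ {v | v ∈ tree N ∧ v.length ≤ n}, (((position Y v : ℤ) : ℝ) : EReal)

/-- `M = sup_n M_n`, the rightmost position ever reached. -/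
def maxEver (N : List ℕ → ℕ) (Y : List ℕ → ℤ) : EReal :=
  ⨆ n : ℕ, maxUpTo N Y n

/-- The random family of offspring numbers `N v` and jumps `Y v`, indexed by all words `v`, drives a
branching random walk with offspring distribution `p` and jump distribution `a`: all the variables
`N v`, `Y v` are independent, each `N v` has law `p` and each `Y v` has law `a`. -/
structure IsDrivenBy {Ω : Type*} [MeasurableSpace Ω] (P : Measure Ω) (p : PMF ℕ) (a : PMF ℤ)
    (N : List ℕ → Ω → ℕ) (Y : List ℕ → Ω → ℤ) : Prop where
  measurable_offspring : ∀ v, Measurable (N v)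
  measurable_jump : ∀ v, Measurable (Y v)
  /-- `N v` has law `p`, `Y v` has law `a`, and they are independent of each other. -/
  law : ∀ v, P.map (fun ω => (N v ω, Y v ω)) = p.toMeasure.prod a.toMeasure
  /-- Different particles behave independently. -/
  indep : iIndepFun (fun v ω => (N v ω, Y v ω)) P

/-- The probability generating function `K(θ) = E(θ ^ W₁)` of the jump distribution. -/
def jumpPGF (a : PMF ℤ) (θ : ℝ) : ℝ := ∑' y : ℤ, (a y).toReal * θ ^ y

end BRW

end

noncomputable section

namespace BRW

open scoped ENNReal

/-! ### Measurability and independence of genealogy and jumps. -/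

section

/-! Two exponential rates are compared. If level `n` is reached, but only after generation `⌊α n⌋`,
then generation `⌊α n⌋ + 1` is nonempty, which by the first moment has probability at most `m ^ (α
n)`. On the other side, `P(M ≥ n)` is at least of order `σ ^ (-n)` for every `σ > ρ`. The condition
on `α` says exactly that `ρ < m ^ (-α)`, so some `σ` fits in between and the quotient tends to `0`.

The lower bound rests on three facts. By a second moment argument, generation `k` survives with
probability at least of order `m ^ k` (`IsDrivenBy.le_measure_survives`). One of its particles can
be selected by looking at the genealogy alone, so its position is that of a `k`-step random walk
`S_k`; hence `P(M ≥ n) ≥ c m ^ k P(S_k ≥ n)` for every `k`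
(`IsDrivenBy.measure_survives_mul_walkLaw_le`). Finally, for `ρ < θ < σ` convexity of `K` gives `m
K(θ) > 1`, so the discounted exponential moments of the walk blow up and some pair `(n₀, k₀)`
satisfies `m ^ k₀ P(S_k₀ ≥ n₀) > σ ^ (-n₀)` (`exists_walkLaw_tail_gt`). Concatenating blocks of `k₀`
steps extends this to all `n`. -/

lemma nil_mem_tree (N : List ℕ → ℕ) : [] ∈ tree N := trivial

lemma cons_mem_tree {N : List ℕ → ℕ} {i : ℕ} {v : List ℕ} :
    i :: v ∈ tree N ↔ v ∈ tree N ∧ i < N v := Iff.rfl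

lemma mem_tree_of_append {N : List ℕ → ℕ} (u : List ℕ) {v : List ℕ} (h : u ++ v ∈ tree N) :
    v ∈ tree N := by
  induction u with
  | nil => exact h
  | cons i u ih => exact ih h.1

variable {Ω : Type*}

/-- The offspring numbers and the jumps as a single family of integer-valued variables. -/
def driver (N : List ℕ → Ω → ℕ) (Y : List ℕ → Ω → ℤ) : List ℕ × Bool → Ω → ℤ
  | (v, true) => fun ω => N v ω
  | (v, false) => Y v

/-- The `σ`-algebra generated by the driving variables with labels in `S`. -/
abbrev field (N : List ℕ → Ω → ℕ) (Y : List ℕ → Ω → ℤ) (S : Set (List ℕ × Bool)) :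
    MeasurableSpace Ω :=
  ⨆ i ∈ S, MeasurableSpace.comap (driver N Y i) ⊤

/-- Labels of the offspring numbers of the particles in the first `k` generations. -/
def earlyOffspring (k : ℕ) : Set (List ℕ × Bool) := {i | i.1.length < k ∧ i.2 = true}

/-- Labels of the jumps of the particles in the first `k` generations. -/
def earlyJumps (k : ℕ) : Set (List ℕ × Bool) := {i | i.1.length < k ∧ i.2 = false}

section Measurability

variable {N : List ℕ → Ω → ℕ} {Y : List ℕ → Ω → ℤ} {S : Set (List ℕ × Bool)}

lemma measurable_driver_field {i : List ℕ × Bool} (hi : i ∈ S) :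
    Measurable[field N Y S] (driver N Y i) := by
  rw [measurable_iff_comap_le]
  exact le_iSup₂_of_le (f := fun i _ => MeasurableSpace.comap (driver N Y i) ⊤) i hi le_rfl

lemma measurable_offspring_field {v : List ℕ} (hv : (v, true) ∈ S) :
    Measurable[field N Y S] (N v) := by
  have h := measurable_driver_field (N := N) (Y := Y) hv
  have h2 : N v = Int.toNat ∘ driver N Y (v, true) := by
    ext ω; simp [driver]
  rw [h2]
  exact (measurable_from_top (f := Int.toNat)).comp h

lemma measurable_jump_field {v : List ℕ} (hv : (v, false) ∈ S) :
    Measurable[field N Y S] (Y v) :=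
  measurable_driver_field (N := N) (Y := Y) hv

lemma measurableSet_mem_tree_field {k : ℕ} (hS : earlyOffspring k ⊆ S) {v : List ℕ}
    (hv : v.length ≤ k) : MeasurableSet[field N Y S] {ω | v ∈ tree (fun u => N u ω)} := by
  induction v with
  | nil => simp [nil_mem_tree]
  | cons i v ih =>
    have h1 := ih (by simp at hv; omega)
    have h2 : MeasurableSet[field N Y S] {ω | i < N v ω} :=
      measurable_offspring_field (N := N) (Y := Y) (v := v)
        (hS ⟨by simpa using hv, rfl⟩) (t := {n | i < n}) trivial
    exact MeasurableSet.inter h1 h2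

lemma measurable_position_field {k : ℕ} (hS : earlyJumps k ⊆ S) {v : List ℕ}
    (hv : v.length ≤ k) :
    Measurable[field N Y S] (fun ω => position (fun u => Y u ω) v) := by
  induction v with
  | nil => exact measurable_const
  | cons i v ih =>
    have h1 := ih (by simp at hv; omega)
    have h2 : Measurable[field N Y S] (Y v) :=
      measurable_jump_field (hS ⟨by simpa using hv, rfl⟩)
    exact Measurable.add h1 h2

end Measurability

section Independence

variable [MeasurableSpace Ω] {P : Measure Ω} {p : PMF ℕ} {a : PMF ℤ}
  {N : List ℕ → Ω → ℕ} {Y : List ℕ → Ω → ℤ}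

lemma IsDrivenBy.measurable_driver (h : IsDrivenBy P p a N Y) (i : List ℕ × Bool) :
    Measurable (driver N Y i) := by
  rcases i with ⟨v, _ | _⟩
  · exact h.measurable_jump v
  · exact measurable_from_top.comp (h.measurable_offspring v)

lemma IsDrivenBy.field_le (h : IsDrivenBy P p a N Y) (S : Set (List ℕ × Bool)) :
    field N Y S ≤ ‹MeasurableSpace Ω› :=
  iSup₂_le fun i _ => (h.measurable_driver i).comap_le

lemma IsDrivenBy.measurableSet_mem_tree (h : IsDrivenBy P p a N Y) (v : List ℕ) :
    MeasurableSet {ω | v ∈ tree (fun u => N u ω)} :=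
  h.field_le _ _ (measurableSet_mem_tree_field (N := N) (Y := Y) subset_rfl le_rfl)

lemma IsDrivenBy.measurable_position (h : IsDrivenBy P p a N Y) (v : List ℕ) :
    Measurable (fun ω => position (fun u => Y u ω) v) :=
  (measurable_position_field (N := N) (Y := Y) subset_rfl le_rfl).mono (h.field_le _) le_rfl

lemma IsDrivenBy.map_offspring (h : IsDrivenBy P p a N Y) (v : List ℕ) :
    P.map (N v) = p.toMeasure := by
  have h1 := congrArg (fun μ => μ.map Prod.fst) (h.law v)
  simp only [Measure.map_fst_prod, measure_univ, one_smul] at h1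
  rwa [Measure.map_map measurable_fst
    ((h.measurable_offspring v).prodMk (h.measurable_jump v))] at h1

lemma IsDrivenBy.map_jump (h : IsDrivenBy P p a N Y) (v : List ℕ) :
    P.map (Y v) = a.toMeasure := by
  have h1 := congrArg (fun μ => μ.map Prod.snd) (h.law v)
  simp only [Measure.map_snd_prod, measure_univ, one_smul] at h1
  rwa [Measure.map_map measurable_snd
    ((h.measurable_offspring v).prodMk (h.measurable_jump v))] at h1

lemma IsDrivenBy.indepFun_offspring_jump [IsProbabilityMeasure P] (h : IsDrivenBy P p a N Y)
    (v : List ℕ) : IndepFun (N v) (Y v) P := by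
  rw [indepFun_iff_map_prod_eq_prod_map_map (h.measurable_offspring v).aemeasurable
    (h.measurable_jump v).aemeasurable, h.law, h.map_offspring, h.map_jump]

lemma iIndepFun_bool {β : Type*} [MeasurableSpace β] [IsProbabilityMeasure P] {f : Bool → Ω → β}
    (h : IndepFun (f true) (f false) P) : iIndepFun f P := by
  rw [iIndepFun_iff_measure_inter_preimage_eq_mul]
  intro S s hs
  have key := indepFun_iff_measure_inter_preimage_eq_mul.1 h
  by_cases h1 : true ∈ S <;> by_cases h2 : false ∈ S
  · have : S = {true, false} := by ext b; cases b <;> simp [h1, h2]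
    subst this
    rw [Finset.prod_pair (by decide), ← key _ _ (hs _ h1) (hs _ h2)]
    congr 1
    ext ω
    simp [and_comm]
  · have : S = {true} := by ext b; cases b <;> simp [h1, h2]
    subst this; simp
  · have : S = {false} := by ext b; cases b <;> simp [h1, h2]
    subst this; simp
  · have : S = ∅ := by ext b; cases b <;> simp [h1, h2]
    subst this; simp

/-- Independence across words and within each pair combine into independence of all coordinates,
which is what separates genealogy from motion. -/
lemma IsDrivenBy.iIndepFun_driver [IsProbabilityMeasure P] (h : IsDrivenBy P p a N Y) :
    iIndepFun (driver N Y) P := by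
  refine iIndepFun_uncurry' (X := fun v b => driver N Y (v, b))
    (fun v b => h.measurable_driver (v, b)) ?_ ?_
  · refine (h.indep.comp (fun _ x b => if b then (x.1 : ℤ) else x.2) fun _ => ?_).congr' ?_
    · exact Measurable.of_discrete
    · intro v
      refine ae_of_all _ fun _ => ae_of_all _ fun ω => ?_
      funext b
      cases b <;> simp [driver]
  · intro v
    exact iIndepFun_bool ((h.indepFun_offspring_jump v).comp
      (measurable_from_top (f := fun n : ℕ => (n : ℤ))) measurable_id)

lemma IsDrivenBy.indep_field [IsProbabilityMeasure P] (h : IsDrivenBy P p a N Y)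
    {S T : Set (List ℕ × Bool)} (hST : Disjoint S T) : Indep (field N Y S) (field N Y T) P :=
  indep_iSup_of_disjoint (fun i => (h.measurable_driver i).comap_le) h.iIndepFun_driver hST

end Independence

end

/-! ### Galton-Watson moments and survival probabilities. -/

section

/-- The words of length `k`, i.e. the potential particles of generation `k`. -/
abbrev Word (k : ℕ) : Type := {v : List ℕ // v.length = k}

/-- A word of length `k + 1` is a parent together with the rank of the child. -/
def wordSuccEquiv (k : ℕ) : Word k × ℕ ≃ Word (k + 1) where
  toFun x := ⟨x.2 :: x.1, by simp [x.1.2]⟩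
  invFun v := (⟨v.1.tail, by simp [v.2]⟩, v.1.headI)
  left_inv x := rfl
  right_inv v := by
    obtain ⟨_ | ⟨i, v⟩, hv⟩ := v
    · simp at hv
    · rfl

/-- The number of particles of generation `k`. -/
def population (N : List ℕ → ℕ) (k : ℕ) : ℝ≥0∞ :=
  ∑' v : Word k, (tree N).indicator 1 v.1

lemma population_zero (N : List ℕ → ℕ) : population N 0 = 1 := by
  rw [population, tsum_eq_single (⟨[], rfl⟩ : Word 0)]
  · simp [nil_mem_tree]
  · rintro ⟨v, hv⟩ h
    exact absurd (Subtype.ext (List.length_eq_zero_iff.1 hv)) h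

lemma population_succ (N : List ℕ → ℕ) (k : ℕ) :
    population N (k + 1) = ∑' v : Word k, (tree N).indicator 1 v.1 * (N v : ℝ≥0∞) := by
  rw [population, ← (wordSuccEquiv k).tsum_eq, ENNReal.tsum_prod']
  refine tsum_congr fun v => ?_
  have h : ∀ i : ℕ, (tree N).indicator (1 : List ℕ → ℝ≥0∞) (wordSuccEquiv k (v, i)).1 =
      (tree N).indicator 1 v.1 * (if i ∈ Finset.range (N v) then 1 else 0) := by
    intro i
    have hw : (wordSuccEquiv k (v, i)).1 = i :: v.1 := rfl
    by_cases h1 : v.1 ∈ tree N <;> by_cases h2 : i < N v <;>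
      simp [hw, Set.indicator, cons_mem_tree, h1, h2]
  simp_rw [h]
  rw [ENNReal.tsum_mul_left, tsum_eq_sum (s := Finset.range (N v)) (by simp +contextual),
    Finset.sum_congr rfl fun i hi => if_pos hi]
  simp

lemma population_pos_iff {N : List ℕ → ℕ} {k : ℕ} :
    population N k ≠ 0 ↔ ∃ v ∈ tree N, v.length = k := by
  simp only [population, ne_eq, ENNReal.tsum_eq_zero, not_forall, Set.indicator_apply_eq_zero]
  simp [and_comm]

lemma one_le_population {N : List ℕ → ℕ} {k : ℕ} (h : ∃ v ∈ tree N, v.length = k) :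
    1 ≤ population N k := by
  obtain ⟨v, hv, hk⟩ := h
  calc (1 : ℝ≥0∞) = (tree N).indicator 1 v := by simp [hv]
    _ ≤ _ := ENNReal.le_tsum (f := fun v : Word k => (tree N).indicator 1 v.1) ⟨v, hk⟩

variable {Ω : Type*}

/-- The indicator of the event that the word `v` is a particle. -/
abbrev alive (N : List ℕ → Ω → ℕ) (v : List ℕ) (ω : Ω) : ℝ≥0∞ :=
  (tree fun u => N u ω).indicator 1 v

lemma alive_eq_indicator (N : List ℕ → Ω → ℕ) (v : List ℕ) :
    alive N v = {ω | v ∈ tree fun u => N u ω}.indicator 1 := by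
  ext ω
  simp [alive, Set.indicator]

lemma measurable_alive_field {N : List ℕ → Ω → ℕ} {Y : List ℕ → Ω → ℤ} {S : Set (List ℕ × Bool)} {k : ℕ} (hS : earlyOffspring k ⊆ S)
    {v : List ℕ} (hv : v.length ≤ k) : Measurable[field N Y S] (alive N v) := by
  rw [alive_eq_indicator]
  have key : ∀ (m₀ : MeasurableSpace Ω) (s : Set Ω), MeasurableSet[m₀] s →
      Measurable[m₀] (s.indicator (1 : Ω → ℝ≥0∞)) := fun m₀ s hs => measurable_one.indicator hs
  exact key _ _ (measurableSet_mem_tree_field hS hv)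

lemma measurable_coe_offspring_field {N : List ℕ → Ω → ℕ} {Y : List ℕ → Ω → ℤ}
    {S : Set (List ℕ × Bool)} {v : List ℕ} (hv : (v, true) ∈ S) :
    Measurable[field N Y S] fun ω => (N v ω : ℝ≥0∞) :=
  measurable_from_top.comp (measurable_offspring_field hv)

variable [MeasurableSpace Ω] {P : Measure Ω} {p : PMF ℕ} {a : PMF ℤ}
  {N : List ℕ → Ω → ℕ} {Y : List ℕ → Ω → ℤ}

lemma lintegral_toMeasure {α : Type*} [Countable α] [MeasurableSpace α]
    [MeasurableSingletonClass α] (q : PMF α) (f : α → ℝ≥0∞) :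
    ∫⁻ x, f x ∂q.toMeasure = ∑' x, q x * f x := by
  rw [lintegral_countable']
  exact tsum_congr fun x => by rw [PMF.toMeasure_apply_singleton _ _ (measurableSet_singleton x),
    mul_comm]

lemma IsDrivenBy.lintegral_offspring (h : IsDrivenBy P p a N Y) (v : List ℕ) (f : ℕ → ℝ≥0∞) :
    ∫⁻ ω, f (N v ω) ∂P = ∑' k, p k * f k := by
  rw [← lintegral_toMeasure, ← h.map_offspring v,
    lintegral_map Measurable.of_discrete (h.measurable_offspring v)]

lemma IsDrivenBy.measurable_alive (h : IsDrivenBy P p a N Y) (v : List ℕ) :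
    Measurable (alive N v) :=
  (measurable_alive_field (N := N) (Y := Y) subset_rfl le_rfl).mono (h.field_le _) le_rfl

lemma IsDrivenBy.measurable_population (h : IsDrivenBy P p a N Y) (k : ℕ) :
    Measurable fun ω => population (fun u => N u ω) k :=
  Measurable.tsum fun v => h.measurable_alive v.1

lemma IsDrivenBy.measurable_coe_offspring (h : IsDrivenBy P p a N Y) (v : List ℕ) :
    Measurable fun ω => (N v ω : ℝ≥0∞) :=
  measurable_from_top.comp (h.measurable_offspring v)

lemma disjoint_earlyOffspring {k : ℕ} {T : Set (List ℕ × Bool)} (hT : ∀ i ∈ T, k ≤ i.1.length) :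
    Disjoint (earlyOffspring k) T :=
  Set.disjoint_left.2 fun i hi hT' => absurd hi.1 (not_lt.2 (hT i hT'))

variable [IsProbabilityMeasure P]

/-- Membership of words of length at most `k` in the tree uses only offspring numbers of shorter
words, so it is independent of what generation `k` does next. -/
lemma IsDrivenBy.lintegral_early_mul (h : IsDrivenBy P p a N Y) {k : ℕ}
    {T : Set (List ℕ × Bool)} (hT : ∀ i ∈ T, k ≤ i.1.length) {f g : Ω → ℝ≥0∞}
    (hf : Measurable[field N Y (earlyOffspring k)] f) (hg : Measurable[field N Y T] g) :
    ∫⁻ ω, f ω * g ω ∂P = (∫⁻ ω, f ω ∂P) * ∫⁻ ω, g ω ∂P :=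
  lintegral_mul_eq_lintegral_mul_lintegral_of_independent_measurableSpace (h.field_le _)
    (h.field_le _) (h.indep_field (disjoint_earlyOffspring hT)) hf hg

lemma IsDrivenBy.lintegral_population (h : IsDrivenBy P p a N Y) (k : ℕ) :
    ∫⁻ ω, population (fun u => N u ω) k ∂P = (∑' k, p k * k) ^ k := by
  induction k with
  | zero => simp [population_zero]
  | succ k ih =>
    simp_rw [population_succ]
    have hmeas : ∀ v : Word k, Measurable fun ω => alive N v ω * (N v ω : ℝ≥0∞) := fun v =>
      (h.measurable_alive v).mul (h.measurable_coe_offspring v)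
    rw [lintegral_tsum fun v : Word k => (hmeas v).aemeasurable]
    have key : ∀ v : Word k, ∫⁻ ω, alive N v ω * (N v ω : ℝ≥0∞) ∂P =
        (∫⁻ ω, alive N v ω ∂P) * ∑' k, p k * k := by
      intro v
      rw [h.lintegral_early_mul (k := k) (T := {(v.1, true)}) (by rintro _ rfl; exact v.2.ge)
        (measurable_alive_field subset_rfl v.2.le)
        (measurable_coe_offspring_field rfl),
        h.lintegral_offspring v fun k => (k : ℝ≥0∞)]
    calc _ = ∑' v : Word k, (∫⁻ ω, alive N v ω ∂P) * ∑' k, p k * k := tsum_congr key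
      _ = _ := by
        rw [ENNReal.tsum_mul_right, ← lintegral_tsum fun v : Word k =>
          (h.measurable_alive v).aemeasurable, pow_succ, ← ih]
        rfl

lemma tsum_mul_tsum_ennreal {α β : Type*} (f : α → ℝ≥0∞) (g : β → ℝ≥0∞) :
    (∑' x, f x) * ∑' y, g y = ∑' x, ∑' y, f x * g y := by
  simp_rw [ENNReal.tsum_mul_left, ENNReal.tsum_mul_right]

/-- The square is a sum over pairs of parents. Distinct parents contribute the factor `m ^ 2`, and
the diagonal adds the second offspring moment times the mean of generation `k`. -/
lemma IsDrivenBy.lintegral_population_sq_succ_le (h : IsDrivenBy P p a N Y) (k : ℕ) :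
    ∫⁻ ω, population (fun u => N u ω) (k + 1) ^ 2 ∂P ≤
      (∑' k, p k * k) ^ 2 * ∫⁻ ω, population (fun u => N u ω) k ^ 2 ∂P +
        (∑' k, p k * k ^ 2) * (∑' k, p k * k) ^ k := by
  set m := ∑' k, p k * (k : ℝ≥0∞) with hm
  set b := ∑' k, p k * (k : ℝ≥0∞) ^ 2 with hb
  have hma : ∀ v w : List ℕ, Measurable fun ω => alive N v ω * alive N w ω := fun v w =>
    (h.measurable_alive v).mul (h.measurable_alive w)
  have hmN : ∀ v w : List ℕ, Measurable fun ω => (N v ω : ℝ≥0∞) * N w ω := fun v w =>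
    (h.measurable_coe_offspring v).mul (h.measurable_coe_offspring w)
  have hmaN : ∀ v w : List ℕ, Measurable fun ω =>
      (alive N v ω * alive N w ω) * ((N v ω : ℝ≥0∞) * N w ω) := fun v w => (hma v w).mul (hmN v w)
  have e1 : ∀ ω, population (fun u => N u ω) (k + 1) ^ 2 = ∑' v : Word k, ∑' w : Word k,
      (alive N v ω * alive N w ω) * ((N v ω : ℝ≥0∞) * N w ω) := by
    intro ω
    rw [population_succ, sq, tsum_mul_tsum_ennreal]
    refine tsum_congr fun v => tsum_congr fun w => ?_
    ring
  have e2 : ∀ ω, population (fun u => N u ω) k ^ 2 = ∑' v : Word k, ∑' w : Word k,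
      (alive N v ω * alive N w ω) := by
    intro ω
    rw [population, sq, tsum_mul_tsum_ennreal]
  have key : ∀ v w : Word k,
      ∫⁻ ω, (alive N v ω * alive N w ω) * ((N v ω : ℝ≥0∞) * N w ω) ∂P ≤
        m ^ 2 * (∫⁻ ω, alive N v ω * alive N w ω ∂P) +
          if w = v then b * ∫⁻ ω, alive N v ω ∂P else 0 := by
    intro v w
    rw [h.lintegral_early_mul (k := k) (T := {(v.1, true), (w.1, true)})
      (by rintro _ (rfl | rfl); exacts [v.2.ge, w.2.ge])
      (f := fun ω => alive N v ω * alive N w ω) (g := fun ω => (N v ω : ℝ≥0∞) * N w ω)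
      ((measurable_alive_field subset_rfl v.2.le).mul (measurable_alive_field subset_rfl w.2.le))
      ((measurable_coe_offspring_field (by simp)).mul (measurable_coe_offspring_field (by simp)))]
    split_ifs with hvw
    · subst hvw
      refine le_add_left ?_
      have : ∫⁻ ω, (N w ω : ℝ≥0∞) * N w ω ∂P = b := by
        rw [hb, ← h.lintegral_offspring w fun k => (k : ℝ≥0∞) ^ 2]
        simp_rw [sq]
      rw [this, mul_comm]
      gcongr with ω
      simp only [alive, Set.indicator]
      split_ifs <;> simp
    · rw [add_zero, mul_comm]
      gcongr
      have hind : IndepFun (fun ω => (N v ω : ℝ≥0∞)) (fun ω => (N w ω : ℝ≥0∞)) P := by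
        have h1 := h.indep.indepFun (i := v.1) (j := w.1) fun e => hvw (Subtype.ext e.symm)
        exact h1.comp (φ := fun x => (x.1 : ℝ≥0∞)) (ψ := fun x => (x.1 : ℝ≥0∞))
          Measurable.of_discrete Measurable.of_discrete
      refine (lintegral_mul_eq_lintegral_mul_lintegral_of_indepFun
        (h.measurable_coe_offspring v) (h.measurable_coe_offspring w) hind).le.trans ?_
      rw [h.lintegral_offspring v fun k => (k : ℝ≥0∞), h.lintegral_offspring w fun k => (k : ℝ≥0∞),
        sq]
  have e3 : ∑' v : Word k, ∫⁻ ω, alive N v ω ∂P = m ^ k := by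
    rw [← lintegral_tsum fun v : Word k => (h.measurable_alive v).aemeasurable,
      hm, ← h.lintegral_population k]
    rfl
  simp_rw [e1, e2]
  rw [lintegral_tsum fun v : Word k => (Measurable.tsum fun w : Word k =>
      hmaN v w).aemeasurable,
    lintegral_tsum fun v : Word k => (Measurable.tsum fun w : Word k =>
      hma v w).aemeasurable, ← e3, ← ENNReal.tsum_mul_left, ← ENNReal.tsum_mul_left,
    ← ENNReal.tsum_add]
  refine ENNReal.tsum_le_tsum fun v => ?_
  rw [lintegral_tsum fun w : Word k => (hmaN v w).aemeasurable,
    lintegral_tsum fun w : Word k => (hma v w).aemeasurable, ← ENNReal.tsum_mul_left,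
    ← tsum_ite_eq v (fun _ => b * ∫⁻ ω, alive N v ω ∂P), ← ENNReal.tsum_add]
  exact ENNReal.tsum_le_tsum fun w => key v w

/-- The condition `hcb` is what makes `c * m ^ k` a supersolution of the second moment recursion. -/
lemma IsDrivenBy.lintegral_population_sq_le (h : IsDrivenBy P p a N Y) {c : ℝ≥0∞} (hc : 1 ≤ c)
    (hcb : (∑' k, p k * (k : ℝ≥0∞)) ^ 2 * c + ∑' k, p k * (k : ℝ≥0∞) ^ 2 ≤
      c * ∑' k, p k * (k : ℝ≥0∞)) (k : ℕ) :
    ∫⁻ ω, population (fun u => N u ω) k ^ 2 ∂P ≤ c * (∑' k, p k * k) ^ k := by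
  induction k with
  | zero => simpa [population_zero] using hc
  | succ k ih =>
    refine (h.lintegral_population_sq_succ_le k).trans ?_
    set m := ∑' k, p k * (k : ℝ≥0∞)
    set b := ∑' k, p k * (k : ℝ≥0∞) ^ 2
    calc m ^ 2 * ∫⁻ ω, population (fun u => N u ω) k ^ 2 ∂P + b * m ^ k
        ≤ m ^ 2 * (c * m ^ k) + b * m ^ k := by gcongr
      _ = (m ^ 2 * c + b) * m ^ k := by ring
      _ ≤ (c * m) * m ^ k := by gcongr
      _ = _ := by ring

/-- The event that generation `k` is not empty. -/
def survives (N : List ℕ → Ω → ℕ) (k : ℕ) : Set Ω :=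
  {ω | ∃ v ∈ tree (fun u => N u ω), v.length = k}

lemma IsDrivenBy.measure_survives_le (h : IsDrivenBy P p a N Y) (k : ℕ) :
    P (survives N k) ≤ (∑' k, p k * (k : ℝ≥0∞)) ^ k := by
  rw [← h.lintegral_population k]
  refine le_trans ?_ (mul_meas_ge_le_lintegral (h.measurable_population k) 1)
  rw [one_mul]
  exact measure_mono fun ω hω => one_le_population hω

/-- Second moment method without division: integrate `2 c Z ≤ Z ^ 2 + c ^ 2 1_{Z ≠ 0}` and cancel
one `c * m ^ k`. -/
lemma IsDrivenBy.le_measure_survives (h : IsDrivenBy P p a N Y) {c : ℝ≥0∞} (hc : 1 ≤ c)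
    (hc' : c ≠ ∞) (hm : ∑' k, p k * (k : ℝ≥0∞) ≠ ∞)
    (hcb : (∑' k, p k * (k : ℝ≥0∞)) ^ 2 * c + ∑' k, p k * (k : ℝ≥0∞) ^ 2 ≤
      c * ∑' k, p k * (k : ℝ≥0∞)) (k : ℕ) :
    c⁻¹ * (∑' k, p k * (k : ℝ≥0∞)) ^ k ≤ P (survives N k) := by
  have hc0 : c ≠ 0 := (zero_lt_one.trans_le hc).ne'
  have hms : MeasurableSet (survives N k) := by
    have : survives N k = (fun ω => population (fun u => N u ω) k) ⁻¹' {0}ᶜ := by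
      ext ω
      exact population_pos_iff.symm
    rw [this]
    exact h.measurable_population k (measurableSet_singleton _).compl
  have key : ∀ ω, 2 * c * population (fun u => N u ω) k ≤
      population (fun u => N u ω) k ^ 2 + c ^ 2 * (survives N k).indicator 1 ω := by
    intro ω
    by_cases hω : ω ∈ survives N k
    · simp only [hω, Set.indicator_of_mem, Pi.one_apply, mul_one]
      generalize population (fun u => N u ω) k = x
      induction x with
      | top => simp
      | coe x =>
        lift c to NNReal using hc'
        norm_cast
        have := two_mul_le_add_sq (x : ℝ) c
        rw [← NNReal.coe_le_coe]
        push_cast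
        linarith
    · have : population (fun u => N u ω) k = 0 := by
        by_contra h0
        exact hω (population_pos_iff.1 h0)
      simp [this]
  have h1 := lintegral_mono (μ := P) key
  rw [lintegral_const_mul _ (h.measurable_population k),
    lintegral_add_left ((h.measurable_population k).pow_const 2),
    lintegral_const_mul _ (measurable_one.indicator hms), lintegral_indicator_one hms,
    h.lintegral_population] at h1
  have h2 := h1.trans (add_le_add_left (h.lintegral_population_sq_le hc hcb k) _)
  set m := ∑' k, p k * (k : ℝ≥0∞)
  have hfin : c * m ^ k ≠ ∞ := ENNReal.mul_ne_top hc' (ENNReal.pow_ne_top hm)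
  have h3 : c * m ^ k ≤ c ^ 2 * P (survives N k) := by
    rw [mul_assoc, two_mul] at h2
    exact (ENNReal.add_le_add_iff_left hfin).1 h2
  have h4 : m ^ k ≤ c * P (survives N k) := by
    rw [sq, mul_assoc] at h3
    exact (ENNReal.mul_le_mul_iff_right hc0 hc').1 h3
  rwa [ENNReal.inv_mul_le_iff hc0 hc']

end

/-! ### Exponential moments and tails of the walk. -/

section

/-- The law of the position after `k` steps of the random walk with jump distribution `a`. -/
def walkLaw (a : PMF ℤ) : ℕ → Measure ℤ
  | 0 => Measure.dirac 0
  | k + 1 => (walkLaw a k).conv a.toMeasure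

instance (a : PMF ℤ) (k : ℕ) : IsProbabilityMeasure (walkLaw a k) := by
  induction k with
  | zero => unfold walkLaw; infer_instance
  | succ k ih => unfold walkLaw; infer_instance

lemma walkLaw_add (a : PMF ℤ) (j k : ℕ) :
    walkLaw a (j + k) = (walkLaw a j).conv (walkLaw a k) := by
  induction k with
  | zero => simp [walkLaw]
  | succ k ih =>
    rw [← add_assoc, walkLaw, ih, walkLaw, Measure.conv_assoc]

/-- Two independent stretches that exceed `s` and `t` together exceed `s + t`. -/
lemma walkLaw_tail_mul_le (a : PMF ℤ) (j k : ℕ) (s t : ℤ) :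
    walkLaw a j (Set.Ici s) * walkLaw a k (Set.Ici t) ≤ walkLaw a (j + k) (Set.Ici (s + t)) := by
  rw [walkLaw_add, Measure.conv, Measure.map_apply measurable_add measurableSet_Ici,
    ← Measure.prod_prod]
  refine measure_mono fun x hx => ?_
  exact add_le_add (Set.mem_Ici.1 (Set.mem_prod.1 hx).1) (Set.mem_Ici.1 (Set.mem_prod.1 hx).2)

lemma walkLaw_tail_pow_le (a : PMF ℤ) (k : ℕ) (t : ℤ) (j : ℕ) :
    walkLaw a k (Set.Ici t) ^ j ≤ walkLaw a (j * k) (Set.Ici (j * t)) := by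
  induction j with
  | zero => simp [walkLaw]
  | succ j ih =>
    have h := walkLaw_tail_mul_le a (j * k) k (j * t) t
    rw [pow_succ, Nat.succ_mul, Nat.cast_succ, add_mul, one_mul]
    exact (mul_le_mul_left ih _).trans h

lemma lintegral_zpow_toMeasure (a : PMF ℤ) {θ : ℝ} (hθ : 0 < θ)
    (hK : Summable fun y : ℤ => (a y).toReal * θ ^ y) :
    ∫⁻ y, ENNReal.ofReal (θ ^ y) ∂a.toMeasure = ENNReal.ofReal (jumpPGF a θ) := by
  rw [lintegral_toMeasure, jumpPGF, ENNReal.ofReal_tsum_of_nonneg (fun y => by positivity) hK]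
  refine tsum_congr fun y => ?_
  rw [ENNReal.ofReal_mul ENNReal.toReal_nonneg, ENNReal.ofReal_toReal (a.apply_ne_top y)]

lemma lintegral_zpow_walkLaw (a : PMF ℤ) {θ : ℝ} (hθ : 0 < θ)
    (hK : Summable fun y : ℤ => (a y).toReal * θ ^ y) (k : ℕ) :
    ∫⁻ y, ENNReal.ofReal (θ ^ y) ∂walkLaw a k = ENNReal.ofReal (jumpPGF a θ) ^ k := by
  induction k with
  | zero => simp [walkLaw]
  | succ k ih =>
    rw [walkLaw, Measure.lintegral_conv Measurable.of_discrete]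
    simp_rw [zpow_add₀ hθ.ne', ENNReal.ofReal_mul (zpow_pos hθ _).le]
    simp_rw [lintegral_const_mul _ (Measurable.of_discrete (f := fun y : ℤ => ENNReal.ofReal (θ ^ y))),
      lintegral_zpow_toMeasure a hθ hK]
    rw [lintegral_mul_const _ Measurable.of_discrete, ih, pow_succ]

/-- A positive `x` is itself one of the levels `n + 1`, so a single term of the series suffices. -/
lemma ofReal_zpow_le {θ : ℝ} (hθ : 1 < θ) (x : ℤ) :
    ENNReal.ofReal (θ ^ x) ≤ 1 + ∑' n : ℕ, ENNReal.ofReal (θ ^ (n + 1)) *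
      (Set.Ici ((n + 1 : ℕ) : ℤ)).indicator 1 x := by
  rcases le_or_gt x 0 with hx | hx
  · refine le_add_right ?_
    rw [← ENNReal.ofReal_one]
    exact ENNReal.ofReal_le_ofReal (zpow_le_one_of_nonpos₀ hθ.le hx)
  · refine le_add_left ?_
    obtain ⟨n, rfl⟩ : ∃ n : ℕ, x = ((n + 1 : ℕ) : ℤ) := ⟨(x - 1).toNat, by omega⟩
    refine le_trans ?_ (ENNReal.le_tsum n)
    rw [zpow_natCast]
    simp

lemma lintegral_zpow_walkLaw_le (a : PMF ℤ) {θ : ℝ} (hθ : 1 < θ) (k : ℕ) :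
    ∫⁻ y, ENNReal.ofReal (θ ^ y) ∂walkLaw a k ≤
      1 + ∑' n : ℕ, ENNReal.ofReal (θ ^ (n + 1)) * walkLaw a k (Set.Ici ((n + 1 : ℕ) : ℤ)) := by
  refine (lintegral_mono (ofReal_zpow_le hθ)).trans ?_
  rw [lintegral_add_left measurable_const, lintegral_tsum fun _ => Measurable.of_discrete.aemeasurable]
  simp_rw [lintegral_const_mul _ (Measurable.of_discrete (f := Set.indicator _ _)),
    lintegral_indicator_one measurableSet_Ici]
  simp

/-- The tails of the walk, discounted by `m` per step, do not decay faster than any geometric rate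
`σ` beyond a point where `m K > 1`. -/
lemma exists_walkLaw_tail_gt (a : PMF ℤ) {m θ σ : ℝ} (hm0 : 0 < m) (hm1 : m ≤ 1) (hθ : 1 < θ)
    (hσ : θ < σ) (hK : Summable fun y : ℤ => (a y).toReal * θ ^ y) (h : 1 < m * jumpPGF a θ) :
    ∃ n k : ℕ, 1 ≤ n ∧ (σ ^ n)⁻¹ < m ^ k * (walkLaw a k).real (Set.Ici (n : ℤ)) := by
  by_contra! hcon
  have hθ0 : 0 < θ := by linarith
  have hσ0 : 0 < σ := by linarith
  set q := θ / σ with hq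
  have hq0 : 0 < q := by positivity
  have hq1 : q < 1 := (div_lt_one hσ0).2 hσ
  have hKpos : 0 < jumpPGF a θ := pos_of_mul_pos_right (by linarith) hm0.le
  have hsum : Summable fun n : ℕ => q ^ (n + 1) :=
    (summable_nat_add_iff 1).2 (summable_geometric_of_lt_one hq0.le hq1)
  set C := ∑' n : ℕ, q ^ (n + 1) with hC
  -- If every discounted tail is at most `σ ^ (-n)`, summing against `θ ^ n` gives a geometric
  -- series of ratio `θ / σ`, bounded uniformly in `k`; but `(m K(θ)) ^ k` is unbounded.
  have bound : ∀ k : ℕ, (m * jumpPGF a θ) ^ k ≤ 1 + C := by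
    intro k
    have hmk : 0 < m ^ k := by positivity
    have h1 := lintegral_zpow_walkLaw_le a hθ k
    rw [lintegral_zpow_walkLaw a hθ0 hK] at h1
    have h2 : ∀ n : ℕ, ENNReal.ofReal (θ ^ (n + 1)) * walkLaw a k (Set.Ici ((n + 1 : ℕ) : ℤ)) ≤
        ENNReal.ofReal ((m ^ k)⁻¹ * q ^ (n + 1)) := by
      intro n
      rw [← ofReal_measureReal, ← ENNReal.ofReal_mul (by positivity)]
      refine ENNReal.ofReal_le_ofReal ?_
      have h3 := hcon (n + 1) k (by omega)
      have h4 : (walkLaw a k).real (Set.Ici ((n + 1 : ℕ) : ℤ)) ≤ (m ^ k)⁻¹ * (σ ^ (n + 1))⁻¹ := by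
        rw [inv_mul_eq_div, le_div_iff₀ hmk, mul_comm]
        exact h3
      calc _ ≤ θ ^ (n + 1) * ((m ^ k)⁻¹ * (σ ^ (n + 1))⁻¹) := by gcongr
        _ = _ := by rw [hq, div_pow]; ring
    have h5 := h1.trans (add_le_add_right (ENNReal.tsum_le_tsum h2) _)
    rw [← ENNReal.ofReal_tsum_of_nonneg (fun n => by positivity) (hsum.mul_left _), tsum_mul_left,
      ← ENNReal.ofReal_pow hKpos.le, ← ENNReal.ofReal_one,
      ← ENNReal.ofReal_add zero_le_one (by positivity),
      ENNReal.ofReal_le_ofReal_iff (by positivity)] at h5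
    rw [mul_pow]
    calc m ^ k * jumpPGF a θ ^ k ≤ m ^ k * (1 + (m ^ k)⁻¹ * C) := by gcongr
      _ = m ^ k + C := by field_simp
      _ ≤ 1 + C := by gcongr; exact pow_le_one₀ hm0.le hm1
  obtain ⟨k, hk⟩ := ((tendsto_pow_atTop_atTop_of_one_lt h).eventually_gt_atTop (1 + C)).exists
  exact absurd (bound k) (not_le.2 hk)

/-! ### The equation `K(ρ) = 1/m`. -/

section GeneratingFunction

variable {a : PMF ℤ}

lemma tsum_toReal_eq_one {α : Type*} (q : PMF α) : ∑' x, (q x).toReal = 1 := by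
  rw [← ENNReal.tsum_toReal_eq fun x => q.apply_ne_top x, q.tsum_coe, ENNReal.toReal_one]

lemma jumpPGF_one : jumpPGF a 1 = 1 := by
  simp [jumpPGF, tsum_toReal_eq_one]

lemma convexOn_jumpPGF
    (hK : ∀ θ : ℝ, 1 ≤ θ → Summable fun y : ℤ => (a y).toReal * θ ^ y) :
    ConvexOn ℝ (Set.Ici 1) (jumpPGF a) := by
  refine ⟨convex_Ici 1, fun x hx y hy s t hs ht hst => ?_⟩
  have hz : s • x + t • y ∈ Set.Ici (1 : ℝ) := convex_Ici 1 hx hy hs ht hst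
  simp only [jumpPGF, smul_eq_mul]
  rw [← tsum_mul_left, ← tsum_mul_left,
    ← ((hK x hx).mul_left s).tsum_add ((hK y hy).mul_left t)]
  refine (hK _ hz).tsum_le_tsum (fun n => ?_)
    (((hK x hx).mul_left s).add ((hK y hy).mul_left t))
  have h := (convexOn_zpow (𝕜 := ℝ) n).2 (Set.mem_Ioi.2 (zero_lt_one.trans_le hx))
    (Set.mem_Ioi.2 (zero_lt_one.trans_le hy)) hs ht hst
  simp only [smul_eq_mul] at h
  calc _ ≤ (a n).toReal * (s * x ^ n + t * y ^ n) := by gcongr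
    _ = _ := by ring

/-- A convex function that has risen above its value `1` at the point `1` increases strictly from
there on. -/
lemma jumpPGF_lt_jumpPGF
    (hK : ∀ θ : ℝ, 1 ≤ θ → Summable fun y : ℤ => (a y).toReal * θ ^ y) {ρ θ : ℝ} (hρ : 1 < ρ)
    (hθ : ρ < θ) (h : 1 < jumpPGF a ρ) : jumpPGF a ρ < jumpPGF a θ :=
  (convexOn_jumpPGF hK).lt_right_of_left_lt (x := 1) (y := θ) (by simp)
    (by simp; linarith) (by rw [openSegment_eq_Ioo (by linarith)]; exact ⟨hρ, hθ⟩)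
    (by rwa [jumpPGF_one])

lemma continuousOn_jumpPGF
    (hK : ∀ θ : ℝ, 1 ≤ θ → Summable fun y : ℤ => (a y).toReal * θ ^ y) (T : ℝ) :
    ContinuousOn (jumpPGF a) (Set.Icc 1 T) := by
  rcases lt_or_ge T 1 with hT | hT
  · simp [Set.Icc_eq_empty (not_le.2 hT)]
  have hone : Summable fun y : ℤ => (a y).toReal := by simpa using hK 1 le_rfl
  -- On `[1, T]`, `x ^ y` is at most `T ^ y` if `y ≥ 0` and at most `1` if `y < 0`.
  refine continuousOn_tsum (u := fun y : ℤ => (a y).toReal * T ^ y + (a y).toReal)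
    (fun y => ?_) ((hK T hT).add hone) fun y x hx => ?_
  · refine continuousOn_const.mul fun x hx => ?_
    exact (continuousAt_zpow₀ x y (Or.inl (by linarith [hx.1]))).continuousWithinAt
  · have hx0 : 0 < x := by linarith [hx.1]
    rw [Real.norm_of_nonneg (by positivity)]
    rcases le_or_gt 0 y with hy | hy
    · have : x ^ y ≤ T ^ y := zpow_le_zpow_left₀ hy hx0.le hx.2
      have h2 := mul_le_mul_of_nonneg_left this (ENNReal.toReal_nonneg (a := a y))
      linarith [ENNReal.toReal_nonneg (a := a y)]
    · have : x ^ y ≤ 1 := zpow_le_one_of_nonpos₀ hx.1 hy.le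
      have h2 := mul_le_mul_of_nonneg_left this (ENNReal.toReal_nonneg (a := a y))
      have h3 : 0 ≤ (a y).toReal * T ^ y := by positivity
      linarith

/-- Without positive jumps the mean is a sum of nonpositive terms equal to zero, which puts all mass
at `0`. -/
lemma exists_pos_jump (ha0 : a 0 ≠ 1)
    (hmean : HasSum (fun y : ℤ => (a y).toReal * (y : ℝ)) 0) : ∃ y : ℤ, 0 < y ∧ a y ≠ 0 := by
  by_contra! h
  have h1 : ∀ y : ℤ, 0 ≤ -((a y).toReal * (y : ℝ)) := by
    intro y
    rcases le_or_gt y 0 with hy | hy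
    · have : (y : ℝ) ≤ 0 := by exact_mod_cast hy
      exact neg_nonneg.2 (mul_nonpos_of_nonneg_of_nonpos ENNReal.toReal_nonneg this)
    · simp [h y hy]
  have h2 := (hasSum_zero_iff_of_nonneg h1).1 (by simpa using hmean.neg)
  refine ha0 ?_
  rw [← a.tsum_coe, tsum_eq_single (0 : ℤ)]
  intro y hy
  have h3 := congrFun h2 y
  simp only [Pi.zero_apply, neg_eq_zero, mul_eq_zero, Int.cast_eq_zero, hy, or_false] at h3
  exact ((ENNReal.toReal_eq_zero_iff _).1 h3).resolve_right (a.apply_ne_top y)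

lemma exists_jumpPGF_eq (ha0 : a 0 ≠ 1)
    (hmean : HasSum (fun y : ℤ => (a y).toReal * (y : ℝ)) 0)
    (hK : ∀ θ : ℝ, 1 ≤ θ → Summable fun y : ℤ => (a y).toReal * θ ^ y) {c : ℝ} (hc : 1 < c) :
    ∃ ρ : ℝ, 1 < ρ ∧ jumpPGF a ρ = c := by
  obtain ⟨y, hy, hay⟩ := exists_pos_jump ha0 hmean
  have hb : 0 < (a y).toReal := ENNReal.toReal_pos hay (a.apply_ne_top y)
  -- Large enough for the single term of `y` to exceed `c`.
  set T := max 1 (c / (a y).toReal) with hT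
  have hT1 : 1 ≤ T := le_max_left _ _
  have h1 : c ≤ jumpPGF a T := by
    calc c = (a y).toReal * (c / (a y).toReal) := by field_simp
      _ ≤ (a y).toReal * T := by gcongr; exact le_max_right _ _
      _ ≤ (a y).toReal * T ^ y := by
        gcongr
        have := zpow_le_zpow_right₀ hT1 (show (1 : ℤ) ≤ y by omega)
        simpa using this
      _ ≤ _ := (hK T hT1).le_tsum y fun z _ => by positivity
  obtain ⟨ρ, hρ, hρc⟩ := intermediate_value_Icc hT1 (continuousOn_jumpPGF hK T)
    (show c ∈ Set.Icc _ _ from ⟨by rw [jumpPGF_one]; exact hc.le, h1⟩)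
  refine ⟨ρ, lt_of_le_of_ne hρ.1 ?_, hρc⟩
  rintro rfl
  rw [jumpPGF_one] at hρc
  exact hc.ne hρc

lemma existsUnique_jumpPGF_eq (ha0 : a 0 ≠ 1)
    (hmean : HasSum (fun y : ℤ => (a y).toReal * (y : ℝ)) 0)
    (hK : ∀ θ : ℝ, 1 ≤ θ → Summable fun y : ℤ => (a y).toReal * θ ^ y) {c : ℝ} (hc : 1 < c) :
    ∃! ρ : ℝ, 1 < ρ ∧ jumpPGF a ρ = c := by
  obtain ⟨ρ, hρ, hρc⟩ := exists_jumpPGF_eq ha0 hmean hK hc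
  refine ⟨ρ, ⟨hρ, hρc⟩, fun θ hθ => ?_⟩
  rcases lt_trichotomy θ ρ with h | h | h
  · have := jumpPGF_lt_jumpPGF hK hθ.1 h (hθ.2 ▸ hc)
    linarith [hθ.2]
  · exact h
  · have := jumpPGF_lt_jumpPGF hK hρ h (hρc ▸ hc)
    linarith [hθ.2]

end GeneratingFunction

/-! ### The law of a particle's position. -/

section Position

variable {Ω : Type*} [MeasurableSpace Ω] {P : Measure Ω} [IsProbabilityMeasure P] {p : PMF ℕ}
  {a : PMF ℤ} {N : List ℕ → Ω → ℕ} {Y : List ℕ → Ω → ℤ}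

lemma IsDrivenBy.map_position (h : IsDrivenBy P p a N Y) (v : List ℕ) :
    P.map (fun ω => position (fun u => Y u ω) v) = walkLaw a v.length := by
  induction v with
  | nil => simp [position, walkLaw]
  | cons i v ih =>
    have hdisj : Disjoint (earlyJumps v.length) {(v, false)} :=
      Set.disjoint_left.2 fun i hi hi' => absurd hi.1 (by rw [Set.mem_singleton_iff.1 hi']; simp)
    have hind : IndepFun (fun ω => position (fun u => Y u ω) v) (Y v) P := by
      rw [IndepFun_iff_Indep]
      exact indep_of_indep_of_le (h.indep_field hdisj)
        (measurable_iff_comap_le.1 (measurable_position_field subset_rfl le_rfl))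
        (measurable_iff_comap_le.1 (measurable_jump_field (Set.mem_singleton _)))
    have := hind.map_add_eq_map_conv_map (h.measurable_position v) (h.measurable_jump v)
    rw [ih, h.map_jump] at this
    exact this

end Position

end

/-! ### Level-crossing events and the lower bound for the maximum. -/

lemma natCast_le_biSup_intCast_iff {α : Type*} {s : Set α} {f : α → ℤ} {n : ℕ} :
    ((n : ℝ) : EReal) ≤ ⨆ v ∈ s, (((f v : ℤ) : ℝ) : EReal) ↔ ∃ v ∈ s, (n : ℤ) ≤ f v := by
  constructor
  · intro h
    by_contra! hcon
    -- Integer values below `n` are at most `n - 1`, so even an unattained supremum stays below `n`.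
    have h1 : ⨆ v ∈ s, (((f v : ℤ) : ℝ) : EReal) ≤ (((n : ℝ) - 1 : ℝ) : EReal) := by
      refine iSup₂_le fun v hv => EReal.coe_le_coe_iff.2 ?_
      have : f v ≤ (n : ℤ) - 1 := by have := hcon v hv; omega
      exact_mod_cast this
    have h2 := EReal.coe_le_coe_iff.1 (h.trans h1)
    linarith
  · rintro ⟨v, hv, h⟩
    refine le_trans ?_ (le_iSup₂_of_le v hv le_rfl)
    exact EReal.coe_le_coe_iff.2 (by exact_mod_cast h)

lemma natCast_le_maxUpTo_iff {N : List ℕ → ℕ} {Y : List ℕ → ℤ} {n k : ℕ} :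
    ((n : ℝ) : EReal) ≤ maxUpTo N Y k ↔
      ∃ v, (v ∈ tree N ∧ v.length ≤ k) ∧ (n : ℤ) ≤ position Y v :=
  natCast_le_biSup_intCast_iff

lemma maxEver_eq (N : List ℕ → ℕ) (Y : List ℕ → ℤ) :
    maxEver N Y = ⨆ v ∈ tree N, (((position Y v : ℤ) : ℝ) : EReal) := by
  refine le_antisymm (iSup_le fun k => iSup₂_le fun v hv => ?_) (iSup₂_le fun v hv => ?_)
  · exact le_iSup₂_of_le (f := fun v _ => (((position Y v : ℤ) : ℝ) : EReal)) v hv.1 le_rfl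
  · refine le_iSup_of_le v.length ?_
    exact le_iSup₂_of_le (f := fun v _ => (((position Y v : ℤ) : ℝ) : EReal)) v ⟨hv, le_rfl⟩ le_rfl

lemma natCast_le_maxEver_iff {N : List ℕ → ℕ} {Y : List ℕ → ℤ} {n : ℕ} :
    ((n : ℝ) : EReal) ≤ maxEver N Y ↔ ∃ v ∈ tree N, (n : ℤ) ≤ position Y v := by
  rw [maxEver_eq, natCast_le_biSup_intCast_iff]

variable {Ω : Type*}

/-- The event that `v` is the first particle of its generation, in the order of codes. -/
def leader (N : List ℕ → Ω → ℕ) (v : List ℕ) : Set Ω :=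
  {ω | v ∈ tree (fun u => N u ω)} ∩
    ⋂ u : Word v.length, {ω | Encodable.encode u.1 < Encodable.encode v →
      u.1 ∉ tree (fun u => N u ω)}

lemma survives_eq_iUnion_leader (N : List ℕ → Ω → ℕ) (k : ℕ) :
    survives N k = ⋃ v : Word k, leader N v.1 := by
  ext ω
  constructor
  · intro h
    have h' : ∃ n, ∃ v : Word k, v.1 ∈ tree (fun u => N u ω) ∧ Encodable.encode v.1 = n := by
      obtain ⟨v, hv, hk⟩ := h
      exact ⟨_, ⟨v, hk⟩, hv, rfl⟩
    classical
    obtain ⟨v, hv, hn⟩ := Nat.find_spec h'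
    refine Set.mem_iUnion.2 ⟨v, hv, Set.mem_iInter.2 fun u hu hut => ?_⟩
    exact Nat.find_min h' (hn ▸ hu) ⟨⟨u.1, u.2.trans v.2⟩, hut, rfl⟩
  · intro h
    obtain ⟨v, hv⟩ := Set.mem_iUnion.1 h
    exact ⟨v.1, hv.1, v.2⟩

lemma pairwise_disjoint_leader (N : List ℕ → Ω → ℕ) (k : ℕ) :
    Pairwise (Function.onFun Disjoint fun v : Word k => leader N v.1) := by
  intro v w hvw
  refine Set.disjoint_left.2 fun ω hv hw => ?_
  have h1 := Set.mem_iInter.1 hv.2 ⟨w.1, w.2.trans v.2.symm⟩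
  have h2 := Set.mem_iInter.1 hw.2 ⟨v.1, v.2.trans w.2.symm⟩
  rcases lt_trichotomy (Encodable.encode v.1) (Encodable.encode w.1) with h | h | h
  · exact h2 h hv.1
  · exact hvw (Subtype.ext (Encodable.encode_injective h))
  · exact h1 h hw.1

lemma measurableSet_leader_field {N : List ℕ → Ω → ℕ} {Y : List ℕ → Ω → ℤ} (v : List ℕ) :
    MeasurableSet[field N Y (earlyOffspring v.length)] (leader N v) := by
  refine MeasurableSet.inter (measurableSet_mem_tree_field subset_rfl le_rfl)
    (MeasurableSet.iInter fun u => ?_)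
  by_cases h : Encodable.encode u.1 < Encodable.encode v
  · simp only [h, forall_const]
    exact (measurableSet_mem_tree_field (N := N) (Y := Y) subset_rfl u.2.le).compl
  · simp [h]

/-- A particle reaching `n` must be born after generation `k`, so it has an ancestor in generation
`k + 1`; since the newest letter comes first, ancestors are suffixes. -/
lemma le_maxEver_diff_subset_survives (N : List ℕ → Ω → ℕ) (Y : List ℕ → Ω → ℤ) (n k : ℕ) :
    {ω | ((n : ℝ) : EReal) ≤ maxEver (fun v => N v ω) (fun v => Y v ω)} ∩
      {ω | ((n : ℝ) : EReal) ≤ maxUpTo (fun v => N v ω) (fun v => Y v ω) k}ᶜ ⊆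
      survives N (k + 1) := by
  rintro ω ⟨h1, h2⟩
  obtain ⟨v, hv, hn⟩ := natCast_le_maxEver_iff.1 h1
  have hk : k < v.length := by
    by_contra! hk
    exact h2 (natCast_le_maxUpTo_iff.2 ⟨v, ⟨hv, hk⟩, hn⟩)
  refine ⟨v.drop (v.length - (k + 1)), ?_, by simp; omega⟩
  exact mem_tree_of_append (v.take (v.length - (k + 1))) (by rwa [List.take_append_drop])

variable [MeasurableSpace Ω] {P : Measure Ω} {p : PMF ℕ}
  {a : PMF ℤ} {N : List ℕ → Ω → ℕ} {Y : List ℕ → Ω → ℤ}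

lemma disjoint_earlyOffspring_earlyJumps (j k : ℕ) :
    Disjoint (earlyOffspring j) (earlyJumps k) :=
  Set.disjoint_left.2 fun _ hi hi' => by simpa [hi.2] using hi'.2

/-- A generation that survives contains a particle whose position has the law of the walk. -/
lemma IsDrivenBy.measure_survives_mul_walkLaw_le [IsProbabilityMeasure P]
    (h : IsDrivenBy P p a N Y) (k : ℕ) (t : ℤ) :
    P (survives N k) * walkLaw a k (Set.Ici t) ≤
      P {ω | ∃ v ∈ tree (fun u => N u ω), t ≤ position (fun u => Y u ω) v} := by
  have hm : ∀ v : Word k, MeasurableSet (leader N v.1) := fun v =>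
    h.field_le _ _ (measurableSet_leader_field (Y := Y) v.1)
  have hm' : ∀ v : Word k, MeasurableSet {ω | t ≤ position (fun u => Y u ω) v.1} := fun v =>
    h.measurable_position v.1 measurableSet_Ici
  have key : ∀ v : Word k, P (leader N v.1) * walkLaw a k (Set.Ici t) =
      P (leader N v.1 ∩ {ω | t ≤ position (fun u => Y u ω) v.1}) := by
    intro v
    -- Being the leader is decided by offspring numbers alone, hence independent of the leader's
    -- position.
    have h1 := (Indep_iff _ _ P).1 (h.indep_field
      (disjoint_earlyOffspring_earlyJumps v.1.length v.1.length)) (leader N v.1)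
      {ω | t ≤ position (fun u => Y u ω) v.1} (measurableSet_leader_field v.1)
      (measurable_position_field (N := N) (Y := Y) subset_rfl le_rfl measurableSet_Ici)
    rw [h1]
    congr 1
    have h2 := h.map_position v.1
    rw [v.2] at h2
    rw [← h2, Measure.map_apply (h.measurable_position v.1) measurableSet_Ici]
    rfl
  rw [survives_eq_iUnion_leader, measure_iUnion (pairwise_disjoint_leader N k) hm,
    ← ENNReal.tsum_mul_right, tsum_congr key, ← measure_iUnion
      (fun v w hvw => (pairwise_disjoint_leader N k hvw).mono Set.inter_subset_left
        Set.inter_subset_left) fun v => (hm v).inter (hm' v)]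
  refine measure_mono (Set.iUnion_subset fun v ω hω => ⟨v.1, hω.1.1, hω.2⟩)

lemma IsDrivenBy.measurableSet_le_maxUpTo (h : IsDrivenBy P p a N Y) (n k : ℕ) :
    MeasurableSet {ω | ((n : ℝ) : EReal) ≤ maxUpTo (fun v => N v ω) (fun v => Y v ω) k} := by
  simp_rw [natCast_le_maxUpTo_iff, Set.ofPred_exists]
  refine MeasurableSet.iUnion fun v => ?_
  exact ((h.measurableSet_mem_tree v).inter (MeasurableSet.const _)).inter
    (h.measurable_position v measurableSet_Ici)

lemma IsDrivenBy.measurableSet_le_maxEver (h : IsDrivenBy P p a N Y) (n : ℕ) :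
    MeasurableSet {ω | ((n : ℝ) : EReal) ≤ maxEver (fun v => N v ω) (fun v => Y v ω)} := by
  simp_rw [natCast_le_maxEver_iff, Set.ofPred_exists]
  refine MeasurableSet.iUnion fun v => ?_
  exact (h.measurableSet_mem_tree v).inter (h.measurable_position v measurableSet_Ici)

variable [IsProbabilityMeasure P]

lemma tsum_offspring_eq {m : ℝ} (hm : HasSum (fun k : ℕ => (p k).toReal * (k : ℝ)) m) :
    ∑' k, p k * (k : ℝ≥0∞) = ENNReal.ofReal m := by
  rw [← hm.tsum_eq, ENNReal.ofReal_tsum_of_nonneg (fun k => by positivity) hm.summable]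
  refine tsum_congr fun k => ?_
  rw [ENNReal.ofReal_mul ENNReal.toReal_nonneg, ENNReal.ofReal_toReal (p.apply_ne_top k),
    ENNReal.ofReal_natCast]

lemma tsum_offspring_sq_eq (hs : Summable fun k : ℕ => (p k).toReal * (k : ℝ) ^ 2) :
    ∑' k, p k * (k : ℝ≥0∞) ^ 2 = ENNReal.ofReal (∑' k, (p k).toReal * (k : ℝ) ^ 2) := by
  rw [ENNReal.ofReal_tsum_of_nonneg (fun k => by positivity) hs]
  refine tsum_congr fun k => ?_
  rw [ENNReal.ofReal_mul ENNReal.toReal_nonneg, ENNReal.ofReal_toReal (p.apply_ne_top k),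
    ENNReal.ofReal_pow (Nat.cast_nonneg k), ENNReal.ofReal_natCast]

/-- A subcritical Galton-Watson process with finite offspring variance survives for `k` generations
with probability at least of order `m ^ k`. -/
lemma IsDrivenBy.exists_le_measure_survives (h : IsDrivenBy P p a N Y) {m : ℝ}
    (hm : HasSum (fun k : ℕ => (p k).toReal * (k : ℝ)) m) (hm0 : 0 < m) (hm1 : m < 1)
    (hs : Summable fun k : ℕ => (p k).toReal * (k : ℝ) ^ 2) :
    ∃ c : ℝ, 0 < c ∧ ∀ k, ENNReal.ofReal (c * m ^ k) ≤ P (survives N k) := by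
  set b := ∑' k, (p k).toReal * (k : ℝ) ^ 2 with hb
  have hb0 : 0 ≤ b := tsum_nonneg fun k => by positivity
  have hm1' : 0 < 1 - m := by linarith
  -- The fraction solves the recursion with equality; the added `1` secures `c ≥ 1` for generation
  -- `0`.
  set c := 1 + b / (m * (1 - m)) with hc
  have hc1 : 1 ≤ c := by rw [hc]; linarith [show 0 ≤ b / (m * (1 - m)) by positivity]
  have hc0 : 0 < c := by linarith
  refine ⟨c⁻¹, by positivity, fun k => ?_⟩
  have key : m ^ 2 * c + b ≤ c * m := by
    have : c * m - m ^ 2 * c - b = m * (1 - m) := by rw [hc]; field_simp; ring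
    nlinarith [mul_pos hm0 hm1']
  have := h.le_measure_survives (c := ENNReal.ofReal c) (by simpa using hc1) ENNReal.ofReal_ne_top
    (by rw [tsum_offspring_eq hm]; exact ENNReal.ofReal_ne_top) (by
      rw [tsum_offspring_eq hm, tsum_offspring_sq_eq hs, ← ENNReal.ofReal_pow hm0.le,
        ← ENNReal.ofReal_mul (by positivity), ← ENNReal.ofReal_mul hc0.le,
        ← ENNReal.ofReal_add (by positivity) hb0]
      exact ENNReal.ofReal_le_ofReal key) k
  rwa [tsum_offspring_eq hm, ← ENNReal.ofReal_inv_of_pos hc0, ← ENNReal.ofReal_pow hm0.le,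
    ← ENNReal.ofReal_mul (by positivity)] at this

/-- The maximum exceeds `n` with probability at least of order `σ ^ (-n)`. -/
lemma IsDrivenBy.exists_le_measure_le_maxEver (h : IsDrivenBy P p a N Y) {m : ℝ}
    (hm : HasSum (fun k : ℕ => (p k).toReal * (k : ℝ)) m) (hm0 : 0 < m) (hm1 : m < 1)
    (hs : Summable fun k : ℕ => (p k).toReal * (k : ℝ) ^ 2) {θ σ : ℝ} (hθ : 1 < θ) (hσ : θ < σ)
    (hK : Summable fun y : ℤ => (a y).toReal * θ ^ y) (hmK : 1 < m * jumpPGF a θ) :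
    ∃ c : ℝ, 0 < c ∧ ∀ n : ℕ, ENNReal.ofReal (c * (σ ^ n)⁻¹) ≤
      P {ω | ((n : ℝ) : EReal) ≤ maxEver (fun v => N v ω) (fun v => Y v ω)} := by
  obtain ⟨c, hc, hsurv⟩ := h.exists_le_measure_survives hm hm0 hm1 hs
  obtain ⟨n₀, k₀, hn₀, hk₀⟩ := exists_walkLaw_tail_gt a hm0 hm1.le hθ hσ hK hmK
  have hσ1 : 1 < σ := hθ.trans hσ
  have hσ0 : 0 < σ := by linarith
  set w := (walkLaw a k₀).real (Set.Ici (n₀ : ℤ)) with hw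
  refine ⟨c * (σ ^ n₀)⁻¹, by positivity, fun n => ?_⟩
  -- Enough blocks to pass `n`, overshooting by at most `n₀`; this costs the constant `(σ ^ n₀)⁻¹`.
  set j := n / n₀ + 1 with hj
  have hj1 : n ≤ j * n₀ := by
    have := Nat.lt_div_mul_add hn₀ (a := n)
    rw [hj, add_mul, one_mul]; exact this.le
  have hj2 : j * n₀ ≤ n₀ + n := by
    have := Nat.div_mul_le_self n n₀
    rw [hj, add_mul, one_mul]; omega
  have h1 := h.measure_survives_mul_walkLaw_le (j * k₀) (j * n₀ : ℤ)
  calc ENNReal.ofReal (c * (σ ^ n₀)⁻¹ * (σ ^ n)⁻¹)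
      ≤ ENNReal.ofReal (c * m ^ (j * k₀) * w ^ j) := by
        refine ENNReal.ofReal_le_ofReal ?_
        rw [mul_assoc, mul_assoc]
        refine mul_le_mul_of_nonneg_left ?_ hc.le
        calc (σ ^ n₀)⁻¹ * (σ ^ n)⁻¹ = (σ ^ (n₀ + n))⁻¹ := by rw [pow_add, mul_inv]
          _ ≤ (σ ^ (j * n₀))⁻¹ :=
            inv_anti₀ (by positivity) (pow_le_pow_right₀ hσ1.le hj2)
          _ = ((σ ^ n₀)⁻¹) ^ j := by rw [mul_comm, pow_mul, inv_pow]
          _ ≤ (m ^ k₀ * w) ^ j := by gcongr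
          _ = _ := by rw [mul_pow, ← pow_mul, mul_comm k₀]
    _ = ENNReal.ofReal (c * m ^ (j * k₀)) * walkLaw a k₀ (Set.Ici (n₀ : ℤ)) ^ j := by
        rw [ENNReal.ofReal_mul (by positivity), ENNReal.ofReal_pow measureReal_nonneg,
          ofReal_measureReal]
    _ ≤ P (survives N (j * k₀)) * walkLaw a (j * k₀) (Set.Ici (j * n₀ : ℤ)) :=
        mul_le_mul' (hsurv _) (walkLaw_tail_pow_le a k₀ n₀ j)
    _ ≤ _ := h1
    _ ≤ _ := by
        refine measure_mono ?_
        rintro ω ⟨v, hv, hle⟩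
        refine natCast_le_maxEver_iff.2 ⟨v, hv, le_trans ?_ hle⟩
        exact_mod_cast hj1

end BRW

end

/-! ### Comparison of the two rates. -/

theorem mainTheorem5 {Ω : Type*} [MeasurableSpace Ω] (P : Measure Ω) [IsProbabilityMeasure P]
    (p : PMF ℕ) (a : PMF ℤ) (N : List ℕ → Ω → ℕ) (Y : List ℕ → Ω → ℤ)
    (hBRW : BRW.IsDrivenBy P p a N Y)
    -- offspring distribution: mean `m ∈ (0, 1)`, finite third moment
    (m : ℝ) (hm : HasSum (fun k : ℕ => (p k).toReal * (k : ℝ)) m) (hm0 : 0 < m) (hm1 : m < 1)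
    (hp3 : Summable (fun k : ℕ => (p k).toReal * (k : ℝ) ^ 3))
    -- jump distribution: nondegenerate, mean zero, finite variance, finite generating function
    (ha0 : a 0 ≠ 1)
    (hmean : HasSum (fun y : ℤ => (a y).toReal * (y : ℝ)) 0)
    (hvar : Summable (fun y : ℤ => (a y).toReal * (y : ℝ) ^ 2))
    (hK : ∀ θ : ℝ, 1 ≤ θ → Summable (fun y : ℤ => (a y).toReal * θ ^ y)) :
    (∃! ρ : ℝ, 1 < ρ ∧ BRW.jumpPGF a ρ = m⁻¹) ∧
    ∀ ρ : ℝ, 1 < ρ → BRW.jumpPGF a ρ = m⁻¹ →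
      ∀ α : ℝ, -(Real.log ρ / Real.log m) < α →
        Tendsto
          (fun n : ℕ =>
            P[{ω | ((n : ℝ) : EReal) ≤
                BRW.maxUpTo (fun v => N v ω) (fun v => Y v ω) ⌊α * (n : ℝ)⌋₊} |
              {ω | ((n : ℝ) : EReal) ≤ BRW.maxEver (fun v => N v ω) (fun v => Y v ω)}])
          atTop (𝓝 1) := by
  have hminv : 1 < m⁻¹ := (one_lt_inv₀ hm0).2 hm1
  refine ⟨BRW.existsUnique_jumpPGF_eq ha0 hmean hK hminv, fun ρ hρ hKρ α hα => ?_⟩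
  have hs : Summable fun k : ℕ => (p k).toReal * (k : ℝ) ^ 2 := by
    refine hp3.of_nonneg_of_le (fun k => by positivity) fun k => ?_
    refine mul_le_mul_of_nonneg_left ?_ ENNReal.toReal_nonneg
    rcases Nat.eq_zero_or_pos k with rfl | hk
    · simp
    · exact pow_le_pow_right₀ (by exact_mod_cast hk) (by norm_num)
  have hρ0 : 0 < ρ := by linarith
  have hlogm : Real.log m < 0 := Real.log_neg hm0 hm1
  have hmα : 0 < m ^ α := Real.rpow_pos_of_pos hm0 α
  -- The hypothesis on `α` after taking logarithms; dividing by `log m < 0` reverses the inequality.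
  have hlt : ρ < (m ^ α)⁻¹ := by
    rw [← Real.log_lt_log_iff hρ0 (by positivity), Real.log_inv, Real.log_rpow hm0]
    rw [← neg_div, div_lt_iff_of_neg hlogm] at hα
    linarith
  obtain ⟨σ, hσ, hσm⟩ := exists_between hlt
  obtain ⟨θ, hθ, hθσ⟩ := exists_between hσ
  have hσ0 : 0 < σ := by linarith
  have hmK : 1 < m * BRW.jumpPGF a θ := by
    have := BRW.jumpPGF_lt_jumpPGF hK hρ hθ (hKρ ▸ hminv)
    rw [hKρ, inv_lt_iff_one_lt_mul₀ hm0] at this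
    linarith
  obtain ⟨c, hc, hlow⟩ := hBRW.exists_le_measure_le_maxEver hm hm0 hm1 hs (hρ.trans hθ) hθσ
    (hK θ (by linarith)) hmK
  -- The upper bound `m ^ (α n)` divided by the lower bound `c σ ^ (-n)`.
  set u : ℕ → ℝ := fun n => c⁻¹ * (m ^ α * σ) ^ n with hu
  have hu0 : Tendsto (fun n => ENNReal.ofReal (u n)) atTop (𝓝 0) := by
    have hq : m ^ α * σ < 1 := by
      rwa [lt_inv_comm₀ hσ0 hmα, ← one_div, lt_div_iff₀ hσ0] at hσm
    have := (tendsto_pow_atTop_nhds_zero_of_lt_one (by positivity) hq).const_mul c⁻¹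
    rw [mul_zero] at this
    simpa using ENNReal.tendsto_ofReal this
  refine tendsto_of_tendsto_of_tendsto_of_le_of_le (g := fun n => 1 - ENNReal.ofReal (u n))
    (h := fun _ => 1) ?_ tendsto_const_nhds (fun n => ?_) fun n => ?_
  · simpa using ENNReal.Tendsto.sub tendsto_const_nhds hu0 (Or.inl ENNReal.one_ne_top)
  · set A := {ω | ((n : ℝ) : EReal) ≤
      BRW.maxUpTo (fun v => N v ω) (fun v => Y v ω) ⌊α * (n : ℝ)⌋₊} with hA
    set B := {ω | ((n : ℝ) : EReal) ≤ BRW.maxEver (fun v => N v ω) (fun v => Y v ω)} with hB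
    have hAm : MeasurableSet A := hBRW.measurableSet_le_maxUpTo n _
    have hBm : MeasurableSet B := hBRW.measurableSet_le_maxEver n
    have hlow' : ENNReal.ofReal (c * (σ ^ n)⁻¹) ≤ P B := hlow n
    have hcσ : 0 < c * (σ ^ n)⁻¹ := by positivity
    have hB0 : P B ≠ 0 := ((ENNReal.ofReal_pos.2 hcσ).trans_le hlow').ne'
    have := cond_isProbabilityMeasure hB0
    have hcompl : P[Aᶜ | B] ≤ ENNReal.ofReal (u n) := by
      rw [cond_apply hBm]
      have h1 : P (B ∩ Aᶜ) ≤ ENNReal.ofReal ((m ^ α) ^ n) := by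
        refine (measure_mono (BRW.le_maxEver_diff_subset_survives N Y n _)).trans
          ((hBRW.measure_survives_le _).trans ?_)
        rw [BRW.tsum_offspring_eq hm, ← ENNReal.ofReal_pow hm0.le]
        refine ENNReal.ofReal_le_ofReal ?_
        rw [← Real.rpow_natCast, ← Real.rpow_natCast, ← Real.rpow_mul hm0.le]
        refine Real.rpow_le_rpow_of_exponent_ge hm0 hm1.le ?_
        push_cast
        -- Survival to generation `⌊α n⌋ + 1`, not just `⌊α n⌋`, makes the exponent at least `α n`.
        exact (Nat.lt_floor_add_one _).le
      calc (P B)⁻¹ * P (B ∩ Aᶜ)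
          ≤ (ENNReal.ofReal (c * (σ ^ n)⁻¹))⁻¹ * ENNReal.ofReal ((m ^ α) ^ n) := by gcongr
        _ = ENNReal.ofReal (u n) := by
          rw [← ENNReal.ofReal_inv_of_pos hcσ, ← ENNReal.ofReal_mul (by positivity)]
          congr 1
          simp only [hu, mul_inv, inv_inv, mul_pow]
          ring
    calc 1 - ENNReal.ofReal (u n) ≤ 1 - P[Aᶜ | B] := tsub_le_tsub_left hcompl 1
      _ = P[A | B] := by rw [← prob_compl_eq_one_sub hAm.compl, compl_compl]
  · by_cases hB : P {ω | ((n : ℝ) : EReal) ≤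
        BRW.maxEver (fun v => N v ω) (fun v => Y v ω)} = 0
    -- Conditioning on a null event yields the zero measure by convention.
    · rw [cond_eq_zero_of_meas_eq_zero hB]
      simp
    · have := cond_isProbabilityMeasure hB
      exact prob_le_one
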